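/- For $a\in\mathbb{C}$ and $n\ge 0$ let $(a)_n=a(a+1)\cdots(a+n-1)$ (with $(a)_0=1$), let $${}_3F_2\left({\alpha_1,\alpha_2,\alpha_3\atop \beta_1,\beta_2};z\right)=\sum_{n=0}^\infty\frac{(\alpha_1)_n(\alpha_2)_n(\alpha_3)_n}{n!\,(\beta_1)_n(\beta_2)_n}z^n,$$ let $\psi=\Gamma'/\Gamma$ be the digamma function and $\gamma$ Euler's constant. Then there is a real number $\delta>0$ such that for all $a,b,c\in\mathbb{C}$ with $|\Re a|<\delta$, $|\Re b|<\delta$, $|\Re c|<\delta$ and $a\neq 0$, $b\neq 0$, $a+b\neq 0$, both series below converge absolutely and $$\begin{aligned}{}_3F_2\left({a,b,c\atop a+b,\,1+c};1\right)={}&\frac{\Gamma(a+b)\Gamma(1+c)\Gamma(1+c-a-b)}{\Gamma(a)\Gamma(b)\Gamma(1+c-a)\Gamma(1+c-b)}\bigl(\psi(1+c-b)-\psi(a)-\psi(b)-\gamma\bigr)\\&-\frac{\Gamma(a+b)\Gamma(1+c)\Gamma(1+c-a-b)}{\Gamma(a)\Gamma(b)\Gamma(1+c-a)\Gamma(1+c-b)}\sum_{n=1}^\infty\frac{(a)_n(1-b)_n}{n\cdot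 n!\,(1+c-b)_n}.\end{aligned}$$ -/

import Mathlib

noncomputable section

/-- The Pochhammer symbol `(a)_n = a (a + 1) ⋯ (a + n - 1)`, with `(a)_0 = 1`. -/
def poch (a : ℂ) (n : ℕ) : ℂ := (ascPochhammer ℂ n).eval a

/-- The `n`-th term of the generalized hypergeometric series `₃F₂(α₁, α₂, α₃; β₁, β₂; z)`. -/
def hyp3F2Term (α₁ α₂ α₃ β₁ β₂ z : ℂ) (n : ℕ) : ℂ :=
  poch α₁ n * poch α₂ n * poch α₃ n / ((n.factorial : ℂ) * poch β₁ n * poch β₂ n) * z ^ n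

/-- The generalized hypergeometric function `₃F₂(α₁, α₂, α₃; β₁, β₂; z)`, as the sum of its
series. -/
def hyp3F2 (α₁ α₂ α₃ β₁ β₂ z : ℂ) : ℂ := ∑' n : ℕ, hyp3F2Term α₁ α₂ α₃ β₁ β₂ z n

/-- The `n`-th term `(a)_n (1 - b)_n / (n · n! · (1 + c - b)_n)`, meant for `n ≥ 1`. -/
def keyTerm (a b c : ℂ) (n : ℕ) : ℂ :=
  poch a n * poch (1 - b) n / ((n : ℂ) * (n.factorial : ℂ) * poch (1 + c - b) n)

/-- The factor
`Γ(a+b) Γ(1+c) Γ(1+c-a-b) / (Γ(a) Γ(b) Γ(1+c-a) Γ(1+c-b))`. -/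
def gammaFactor (a b c : ℂ) : ℂ :=
  Complex.Gamma (a + b) * Complex.Gamma (1 + c) * Complex.Gamma (1 + c - a - b) /
    (Complex.Gamma a * Complex.Gamma b * Complex.Gamma (1 + c - a) * Complex.Gamma (1 + c - b))

end

open Filter Topology

/-! Fix `a`, `b` and vary `c`. Put t_n = (a)_n(b)_n/((a+b)_n n!), K = Γ(a+b)/(Γ(a)Γ(b)), q(c) =
`gammaRatio`, B(c) = `digammaBracket`. The claim is that D(c) = ₃F₂(c)/q(c) − K·B(c), the
`evaluationDefect`, vanishes.

D has period 1. Telescoping gives a first-order recurrence for ₃F₂ in `c` (`hyp3F2_recurrence`) with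
inhomogeneous term K = lim n·t_n. Dividing by q turns this term into an increment, which K·B
reproduces by Gauss' theorem (`Admissible.digammaBracket_add_one`).

Also D(c+N) − D(N) → 0 (`Admissible.tendsto_evaluationDefect_sub`), so D(c) = D(0). ₃F₂ need not
stay bounded as N grows, so the argument uses differences, ₃F₂(N) = o(N) and q(c+N) − 1 = O(1/N).

Finally D(0) = 0 (`evaluationDefect_zero`): there ₃F₂ = 1, the auxiliary series is −γ − ψ(1−a), and
the reflection formulas for Γ and ψ reduce the claim to the addition formula for the sine. -/

/-! ### Pochhammer symbols and Euler's limit for Γ. -/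

theorem poch_zero (a : ℂ) : poch a 0 = 1 := by simp [poch]

theorem poch_succ (a : ℂ) (n : ℕ) : poch a (n + 1) = poch a n * (a + n) := by
  simp [poch, ascPochhammer_succ_eval]

theorem poch_succ_left (a : ℂ) (n : ℕ) : poch a (n + 1) = a * poch (a + 1) n := by
  simp [poch, ascPochhammer_succ_left, Polynomial.eval_comp]

theorem poch_one (n : ℕ) : poch 1 n = n.factorial := by
  induction n with
  | zero => simp [poch_zero]
  | succ n ih => rw [poch_succ, ih, Nat.factorial_succ]; push_cast; ring

theorem poch_eq_prod (a : ℂ) (n : ℕ) : poch a n = ∏ j ∈ Finset.range n, (a + j) := by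
  induction n with
  | zero => simp [poch_zero]
  | succ n ih => rw [poch_succ, ih, Finset.prod_range_succ]

theorem ne_neg_nat_of_re_pos {s : ℂ} (hs : 0 < s.re) (m : ℕ) : s ≠ -m := by
  rintro rfl
  simp at hs
  have : (0 : ℝ) ≤ m := m.cast_nonneg
  linarith

theorem add_natCast_ne_zero {s : ℂ} (hs : ∀ m : ℕ, s ≠ -m) (n : ℕ) : s + n ≠ 0 := fun h =>
  hs n (eq_neg_of_add_eq_zero_left h)

theorem poch_ne_zero {s : ℂ} (hs : ∀ m : ℕ, s ≠ -m) (n : ℕ) : poch s n ≠ 0 := by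
  rw [poch_eq_prod]
  exact Finset.prod_ne_zero_iff.2 fun j _ => add_natCast_ne_zero hs j

theorem inv_GammaSeq (a : ℂ) (n : ℕ) :
    (Complex.GammaSeq a n)⁻¹ = poch a (n + 1) / ((n : ℂ) ^ a * n.factorial) := by
  rw [Complex.GammaSeq, poch_eq_prod, inv_div]

/-- The reciprocal form also covers the poles of Γ: at a = −m the product contains the factor 0 once
n ≥ m, and `Complex.Gamma` takes the value 0 there, with 0⁻¹ = 0. -/
theorem tendsto_inv_GammaSeq (a : ℂ) :
    Tendsto (fun n => (Complex.GammaSeq a n)⁻¹) atTop (𝓝 (Complex.Gamma a)⁻¹) := by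
  by_cases h : Complex.Gamma a = 0
  · obtain ⟨m, rfl⟩ := Complex.Gamma_eq_zero_iff _ |>.1 h
    rw [h, inv_zero]
    refine tendsto_const_nhds.congr' ?_
    filter_upwards [eventually_ge_atTop m] with n hn
    rw [inv_GammaSeq, poch_eq_prod, Finset.prod_eq_zero (Finset.mem_range.2 (Nat.lt_succ_of_le hn))]
    · simp
    · simp
  · exact (Complex.GammaSeq_tendsto_Gamma a).inv₀ h

/-- Quotients of Pochhammer symbols grow like powers. -/
theorem tendsto_poch_ratio (a b : ℂ) {c d : ℂ} (hc : ∀ m : ℕ, c ≠ -m) (hd : ∀ m : ℕ, d ≠ -m) :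
    Tendsto (fun n : ℕ => (n : ℂ) ^ (c + d - a - b) *
      (poch a (n + 1) * poch b (n + 1) / (poch c (n + 1) * poch d (n + 1)))) atTop
      (𝓝 (Complex.Gamma c * Complex.Gamma d / (Complex.Gamma a * Complex.Gamma b))) := by
  have h := (((tendsto_inv_GammaSeq a).mul (tendsto_inv_GammaSeq b)).mul
    (Complex.GammaSeq_tendsto_Gamma c)).mul (Complex.GammaSeq_tendsto_Gamma d)
  have e : (Complex.Gamma a)⁻¹ * (Complex.Gamma b)⁻¹ * Complex.Gamma c * Complex.Gamma d =
      Complex.Gamma c * Complex.Gamma d / (Complex.Gamma a * Complex.Gamma b) := by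
    rw [div_eq_mul_inv, mul_inv]; ring
  rw [e] at h
  refine h.congr' ?_
  filter_upwards [eventually_ge_atTop 1] with n hn
  have hn0 : (n : ℂ) ≠ 0 := by exact_mod_cast (by omega : n ≠ 0)
  have hf : (n.factorial : ℂ) ≠ 0 := by exact_mod_cast n.factorial_ne_zero
  have h1 := poch_ne_zero hc (n + 1)
  have h2 := poch_ne_zero hd (n + 1)
  have hna : (n : ℂ) ^ a ≠ 0 := by simp [Complex.cpow_eq_zero_iff, hn0]
  have hnb : (n : ℂ) ^ b ≠ 0 := by simp [Complex.cpow_eq_zero_iff, hn0]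
  rw [inv_GammaSeq, inv_GammaSeq, Complex.GammaSeq, Complex.GammaSeq, ← poch_eq_prod,
    ← poch_eq_prod, Complex.cpow_sub _ _ hn0, Complex.cpow_sub _ _ hn0, Complex.cpow_add _ _ hn0]
  field_simp

/-! ### Gauss' summation theorem, with a rate of convergence in the lower parameter. -/

/-- The `n`-th term of Gauss' series `₂F₁(a, b; c; 1)`. -/
noncomputable def gaussTerm (a b c : ℂ) (n : ℕ) : ℂ :=
  poch a n * poch b n / (poch c n * n.factorial)

theorem gaussTerm_zero (a b c : ℂ) : gaussTerm a b c 0 = 1 := by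
  simp [gaussTerm, poch_zero]

theorem gaussTerm_succ (a b : ℂ) {c : ℂ} (hc : ∀ m : ℕ, c ≠ -m) (n : ℕ) :
    gaussTerm a b c (n + 1) * ((n + 1) * (c + n)) = gaussTerm a b c n * ((a + n) * (b + n)) := by
  have h1 := poch_ne_zero hc n
  have h2 := add_natCast_ne_zero hc n
  have hf : (n.factorial : ℂ) ≠ 0 := by exact_mod_cast n.factorial_ne_zero
  have h3 : (n : ℂ) + 1 ≠ 0 := by exact_mod_cast n.succ_ne_zero
  rw [gaussTerm, gaussTerm, poch_succ, poch_succ, poch_succ, Nat.factorial_succ]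
  push_cast
  field_simp

theorem gaussTerm_add_one_right (a b : ℂ) {c : ℂ} (hc : ∀ m : ℕ, c ≠ -m) (n : ℕ) :
    gaussTerm a b (c + 1) n * (c + n) = gaussTerm a b c n * c := by
  have h1 := poch_ne_zero hc n
  have h0 : c ≠ 0 := by simpa using hc 0
  have h2 := add_natCast_ne_zero hc n
  have h4 : c * poch (c + 1) n = poch c n * (c + n) := by rw [← poch_succ_left, poch_succ]
  have h3 : poch (c + 1) n ≠ 0 := by
    intro h; rw [h, mul_zero] at h4; exact mul_ne_zero h1 h2 h4.symm
  have hf : (n.factorial : ℂ) ≠ 0 := by exact_mod_cast n.factorial_ne_zero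
  rw [gaussTerm, gaussTerm]
  field_simp
  linear_combination (-poch a n * poch b n) * h4

theorem tendsto_gaussTerm (a b : ℂ) {c : ℂ} (hc : ∀ m : ℕ, c ≠ -m) :
    Tendsto (fun n : ℕ => (n : ℂ) ^ (c + 1 - a - b) * gaussTerm a b c (n + 1)) atTop
      (𝓝 (Complex.Gamma c / (Complex.Gamma a * Complex.Gamma b))) := by
  have := tendsto_poch_ratio a b hc (d := 1) (ne_neg_nat_of_re_pos (by simp))
  simpa [gaussTerm, poch_one] using this

theorem isBigO_gaussTerm (a b : ℂ) {c : ℂ} (hc : ∀ m : ℕ, c ≠ -m) :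
    (fun n : ℕ => gaussTerm a b c (n + 1)) =O[atTop]
      fun n : ℕ => (n : ℝ) ^ (-(1 + (c - a - b).re)) := by
  have h := (tendsto_gaussTerm a b hc).isBigO_one ℝ
  obtain ⟨C, hC⟩ := h.bound
  refine Asymptotics.IsBigO.of_bound C ?_
  filter_upwards [hC, eventually_ge_atTop 1] with n hn h1
  have hpos : 0 < n := h1
  rw [norm_mul, Complex.norm_natCast_cpow_of_pos hpos] at hn
  have hre : (c + 1 - a - b).re = 1 + (c - a - b).re := by simp; ring
  have hnpos : (0 : ℝ) < n := by exact_mod_cast hpos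
  rw [Real.rpow_neg hnpos.le, norm_inv, Real.norm_of_nonneg (by positivity), ← div_eq_mul_inv,
    le_div_iff₀ (by positivity), mul_comm, ← hre]
  simpa using hn

theorem summable_norm_gaussTerm (a b : ℂ) {c : ℂ} (hc : ∀ m : ℕ, c ≠ -m)
    (h : 0 < (c - a - b).re) : Summable fun n => ‖gaussTerm a b c n‖ := by
  rw [← summable_nat_add_iff 1]
  refine summable_of_isBigO_nat ?_ (isBigO_gaussTerm a b hc).norm_left
  exact Real.summable_nat_rpow.2 (by linarith)

theorem tendsto_nat_mul_gaussTerm (a b : ℂ) {c : ℂ} (hc : ∀ m : ℕ, c ≠ -m)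
    (h : 0 < (c - a - b).re) :
    Tendsto (fun n : ℕ => (n : ℂ) * gaussTerm a b c n) atTop (𝓝 0) := by
  rw [← tendsto_add_atTop_iff_nat 1]
  have h1 : (fun n : ℕ => (((n + 1 : ℕ)) : ℂ)) =O[atTop] fun n : ℕ => (n : ℝ) := by
    refine Asymptotics.IsBigO.of_bound 2 ?_
    filter_upwards [eventually_ge_atTop 1] with n hn
    rw [Complex.norm_natCast, Real.norm_natCast]
    have : (1 : ℝ) ≤ n := by exact_mod_cast hn
    push_cast; linarith
  refine (h1.mul (isBigO_gaussTerm a b hc)).trans_tendsto ?_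
  refine ((tendsto_rpow_neg_atTop h).comp tendsto_natCast_atTop_atTop).congr' ?_
  filter_upwards [eventually_ge_atTop 1] with n hn
  have hnpos : (0 : ℝ) < n := by exact_mod_cast hn
  simp only [Function.comp]
  rw [show -(c - a - b).re = 1 + -(1 + (c - a - b).re) by ring, Real.rpow_add hnpos, Real.rpow_one]

theorem hasSum_of_eq_sub {f v : ℕ → ℂ} {l : ℂ} (hf : Summable f)
    (h : ∀ n, f n = v n - v (n + 1)) (hv : Tendsto v atTop (𝓝 l)) : HasSum f (v 0 - l) := by
  have h1 := hf.hasSum.tendsto_sum_nat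
  have h2 : Tendsto (fun n => v 0 - v n) atTop (𝓝 (v 0 - l)) := tendsto_const_nhds.sub hv
  have h3 : (fun n => ∑ i ∈ Finset.range n, f i) = fun n => v 0 - v n := by
    funext n
    rw [Finset.sum_congr rfl fun i _ => h i, Finset.sum_range_sub']
  rw [h3] at h1
  rw [← tendsto_nhds_unique h1 h2]
  exact hf.hasSum

/-- Contiguous relation by telescoping: the combined summand is v n − v (n+1) with v n = c·n·t_n,
t_n being the Gauss term, and n·t_n → 0 because Re(c−a−b) > 0. -/
theorem tsum_gaussTerm_add_one_right (a b : ℂ) {c : ℂ} (hc : 0 < c.re)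
    (h : 0 < (c - a - b).re) :
    c * (c - a - b) * ∑' n, gaussTerm a b c n =
      (c - a) * (c - b) * ∑' n, gaussTerm a b (c + 1) n := by
  have hc' := ne_neg_nat_of_re_pos hc
  have hc1 : ∀ m : ℕ, c + 1 ≠ -m := ne_neg_nat_of_re_pos (by simp; linarith)
  have s1 := (summable_norm_gaussTerm a b hc' h).of_norm
  have s2 := (summable_norm_gaussTerm a b hc1 (by simp at h ⊢; linarith)).of_norm
  have key := hasSum_of_eq_sub (v := fun n => c * (n * gaussTerm a b c n)) (l := 0)
    ((s1.mul_left (c * (c - a - b))).sub (s2.mul_left ((c - a) * (c - b)))) ?_ ?_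
  · have := key.unique ((s1.hasSum.mul_left _).sub (s2.hasSum.mul_left _))
    simp at this
    exact (sub_eq_zero.1 this.symm)
  · intro n
    have h0 := add_natCast_ne_zero hc' n
    have e1 := gaussTerm_succ a b hc' n
    have e2 := gaussTerm_add_one_right a b hc' n
    apply mul_right_cancel₀ h0
    push_cast
    linear_combination (-(c - a) * (c - b)) * e2 + c * e1
  · simpa using (tendsto_nat_mul_gaussTerm a b hc' h).const_mul c

theorem norm_add_natCast_le {x : ℂ} (hx : 0 < x.re) (N j : ℕ) : ‖x + j‖ ≤ ‖x + N + j‖ := by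
  have hj : (0 : ℝ) ≤ j := j.cast_nonneg
  have hN : (0 : ℝ) ≤ N := N.cast_nonneg
  rw [Complex.norm_def, Complex.norm_def]
  apply Real.sqrt_le_sqrt
  simp only [Complex.normSq_apply, Complex.add_re, Complex.add_im, Complex.natCast_re,
    Complex.natCast_im, add_zero]
  nlinarith

theorem norm_poch_le {x : ℂ} (hx : 0 < x.re) (N n : ℕ) : ‖poch x n‖ ≤ ‖poch (x + N) n‖ := by
  rw [poch_eq_prod, poch_eq_prod, norm_prod, norm_prod]
  exact Finset.prod_le_prod (fun _ _ => norm_nonneg _) fun j _ => norm_add_natCast_le hx N j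

theorem natCast_le_norm {x : ℂ} (hx : 0 < x.re) (N : ℕ) : (N : ℝ) ≤ ‖x + N‖ := by
  refine le_trans ?_ (Complex.re_le_norm _)
  simp; linarith

/-- Shifting by `N` enlarges every factor in modulus, and the first one becomes at least `N`. This
gains a factor 1/N uniformly in `n`. -/
theorem natCast_mul_norm_poch_le {x : ℂ} (hx : 0 < x.re) (N n : ℕ) :
    N * ‖poch x (n + 1)‖ ≤ ‖x‖ * ‖poch (x + N) (n + 1)‖ := by
  have hx1 : 0 < (x + 1).re := by simp; linarith
  rw [poch_succ_left, poch_succ_left, norm_mul, norm_mul,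
    show x + N + 1 = x + 1 + N by ring]
  have h1 := norm_poch_le hx1 N n
  have h2 := natCast_le_norm hx N
  calc (N : ℝ) * (‖x‖ * ‖poch (x + 1) n‖) = ‖x‖ * (N * ‖poch (x + 1) n‖) := by ring
    _ ≤ _ := by gcongr

theorem natCast_mul_norm_gaussTerm_le (a b : ℂ) {x : ℂ} (hx : 0 < x.re) (N n : ℕ) :
    N * ‖gaussTerm a b (x + N) (n + 1)‖ ≤ ‖x‖ * ‖gaussTerm a b x (n + 1)‖ := by
  have h0 : 0 < ‖poch x (n + 1)‖ := norm_pos_iff.2 (poch_ne_zero (ne_neg_nat_of_re_pos hx) _)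
  have h1 : 0 < ‖poch (x + N) (n + 1)‖ := h0.trans_le (norm_poch_le hx N _)
  have hf : 0 < ‖((n + 1).factorial : ℂ)‖ :=
    norm_pos_iff.2 (by exact_mod_cast (n + 1).factorial_ne_zero)
  have := natCast_mul_norm_poch_le hx N n
  rw [gaussTerm, gaussTerm, norm_div, norm_div, norm_mul (poch x _), norm_mul (poch (x + N) _),
    ← mul_div_assoc, ← mul_div_assoc, div_le_div_iff₀ (by positivity) (by positivity)]
  calc _ = ‖poch a (n + 1) * poch b (n + 1)‖ * ‖((n + 1).factorial : ℂ)‖ *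
        (N * ‖poch x (n + 1)‖) := by ring
    _ ≤ ‖poch a (n + 1) * poch b (n + 1)‖ * ‖((n + 1).factorial : ℂ)‖ *
        (‖x‖ * ‖poch (x + N) (n + 1)‖) := by gcongr
    _ = _ := by ring

/-- The rate O(1/N), and not only the limit 1, is needed later against the possible growth of ₃F₂.
-/
theorem natCast_mul_norm_tsum_gaussTerm_sub_one_le (a b : ℂ) {x : ℂ} (hx : 0 < x.re)
    (h : 0 < (x - a - b).re) (N : ℕ) :
    N * ‖∑' n, gaussTerm a b (x + N) n - 1‖ ≤ ‖x‖ * ∑' n, ‖gaussTerm a b x (n + 1)‖ := by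
  have hN : (0 : ℝ) ≤ N := N.cast_nonneg
  have hxN : ∀ m : ℕ, x + N ≠ -m := ne_neg_nat_of_re_pos (by simp; linarith)
  have s1 := summable_norm_gaussTerm a b (ne_neg_nat_of_re_pos hx) h
  have s2 := summable_norm_gaussTerm a b hxN (by simp at h ⊢; linarith)
  have s1' := (summable_nat_add_iff 1).2 s1
  have s2' := (summable_nat_add_iff 1).2 s2
  rw [s2.of_norm.tsum_eq_zero_add, gaussTerm_zero, add_sub_cancel_left, ← tsum_mul_left]
  calc _ ≤ N * ∑' n, ‖gaussTerm a b (x + N) (n + 1)‖ := by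
        gcongr; exact norm_tsum_le_tsum_norm s2'
    _ = ∑' n, N * ‖gaussTerm a b (x + N) (n + 1)‖ := tsum_mul_left.symm
    _ ≤ _ := (s2'.mul_left _).tsum_le_tsum (fun n => natCast_mul_norm_gaussTerm_le a b hx N n)
        (s1'.mul_left _)

theorem tendsto_zero_of_natCast_mul_le {f : ℕ → ℂ} {C : ℝ} (h : ∀ N : ℕ, N * ‖f N‖ ≤ C) :
    Tendsto f atTop (𝓝 0) := by
  refine squeeze_zero_norm' (a := fun N : ℕ => C / N) ?_ (tendsto_const_div_atTop_nhds_zero_nat C)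
  filter_upwards [eventually_ge_atTop 1] with N hN
  have : (0 : ℝ) < N := by exact_mod_cast hN
  rw [le_div_iff₀ this, mul_comm]
  exact h N

theorem tendsto_tsum_gaussTerm (a b : ℂ) {x : ℂ} (hx : 0 < x.re) (h : 0 < (x - a - b).re) :
    Tendsto (fun N : ℕ => ∑' n, gaussTerm a b (x + N) n) atTop (𝓝 1) := by
  have := tendsto_zero_of_natCast_mul_le (natCast_mul_norm_tsum_gaussTerm_sub_one_le a b hx h)
  simpa using this.add_const 1

theorem poch_mul_tsum_gaussTerm (a b : ℂ) {c : ℂ} (hc : 0 < c.re) (h : 0 < (c - a - b).re)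
    (N : ℕ) : poch c N * poch (c - a - b) N * ∑' n, gaussTerm a b c n =
      poch (c - a) N * poch (c - b) N * ∑' n, gaussTerm a b (c + N) n := by
  induction N with
  | zero => simp [poch_zero]
  | succ N ih =>
    have hN : (0 : ℝ) ≤ N := N.cast_nonneg
    have e := tsum_gaussTerm_add_one_right a b (c := c + N) (by simp; linarith)
      (by simp at h ⊢; linarith)
    rw [poch_succ, poch_succ, poch_succ, poch_succ]
    push_cast
    rw [← add_assoc]
    linear_combination ((c + N) * (c - a - b + N)) * ih + (poch (c - a) N * poch (c - b) N) * e

/-- **Gauss' summation theorem** for `₂F₁(a, b; c; 1)`. -/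
theorem tsum_gaussTerm (a b : ℂ) {c : ℂ} (hc : 0 < c.re) (h : 0 < (c - a - b).re) :
    ∑' n, gaussTerm a b c n = Complex.Gamma c * Complex.Gamma (c - a - b) /
      (Complex.Gamma (c - a) * Complex.Gamma (c - b)) := by
  have hc' := ne_neg_nat_of_re_pos hc
  have hd' := ne_neg_nat_of_re_pos h
  have h1 := (tendsto_poch_ratio (c - a) (c - b) hc' hd').mul
    ((tendsto_add_atTop_iff_nat 1).2 (tendsto_tsum_gaussTerm a b hc h))
  rw [mul_one] at h1
  refine tendsto_nhds_unique (tendsto_const_nhds.congr fun n => ?_) h1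
  have e := poch_mul_tsum_gaussTerm a b hc h (n + 1)
  have n1 := poch_ne_zero hc' (n + 1)
  have n2 := poch_ne_zero hd' (n + 1)
  -- For these four parameters the exponent of `n` in `tendsto_poch_ratio` is zero.
  rw [show c + (c - a - b) - (c - a) - (c - b) = 0 by ring, Complex.cpow_zero, one_mul]
  field_simp
  linear_combination e

/-! ### Asymptotics of ψ along integer shifts. -/

/-- Log-convexity of Γ (Bohr–Mollerup) bounds Euler's sequence by its limit. This supplies a
majorant independent of `n`. -/
theorem GammaSeq_real_le_Gamma {x : ℝ} (hx : 0 < x) {n : ℕ} (hn : n ≠ 0) :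
    (n : ℝ) ^ x * n.factorial / ∏ j ∈ Finset.range (n + 1), (x + j) ≤ Real.Gamma x := by
  have h := Real.BohrMollerup.ge_logGammaSeq Real.convexOn_log_Gamma
    (fun {y} hy => by
      simp only [Function.comp]
      rw [Real.Gamma_add_one hy.ne', Real.log_mul hy.ne' (Real.Gamma_pos_of_pos hy).ne', add_comm])
    hx hn
  have hn' : (0 : ℝ) < n := by exact_mod_cast Nat.pos_of_ne_zero hn
  have hp : ∀ j ∈ Finset.range (n + 1), 0 < x + (j : ℝ) := fun j _ => by positivity
  have hf : (0 : ℝ) < n.factorial := by exact_mod_cast n.factorial_pos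
  have hP := Finset.prod_pos hp
  simp only [Function.comp, Real.Gamma_one, Real.log_one, zero_add,
    Real.BohrMollerup.logGammaSeq] at h
  rw [← Real.log_le_log_iff (by positivity) (Real.Gamma_pos_of_pos hx),
    Real.log_div (by positivity) hP.ne', Real.log_mul (by positivity) hf.ne', Real.log_rpow hn',
    Real.log_prod (fun j hj => (hp j hj).ne')]
  exact h

theorem norm_GammaSeq_le {s : ℂ} (hs : 0 < s.re) {n : ℕ} (hn : n ≠ 0) :
    ‖Complex.GammaSeq s n‖ ≤ Real.Gamma s.re := by
  refine le_trans ?_ (GammaSeq_real_le_Gamma hs hn)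
  rw [Complex.GammaSeq, norm_div, norm_mul, norm_prod,
    Complex.norm_natCast_cpow_of_pos (Nat.pos_of_ne_zero hn), Complex.norm_natCast]
  have hp : ∀ j ∈ Finset.range (n + 1), 0 < s.re + (j : ℝ) := fun j _ => by positivity
  have hP := Finset.prod_pos hp
  gcongr with j hj
  refine le_trans (le_of_eq ?_) (Complex.re_le_norm _)
  simp

/-- Pointwise convergence of holomorphic functions that are dominated on a circle implies
convergence of the derivatives at its centre. -/
theorem tendsto_deriv_of_dominated {F : ℕ → ℂ → ℂ} {f : ℂ → ℂ} {U : Set ℂ} {z : ℂ} {r : ℝ}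
    (hU : IsOpen U) (hr : 0 < r) (hzr : Metric.closedBall z r ⊆ U)
    (hF : ∀ n, DifferentiableOn ℂ (F n) U) (hf : DifferentiableOn ℂ f U) {g : ℂ → ℝ}
    (hg : ContinuousOn g U) (hFg : ∀ᶠ n in atTop, ∀ w ∈ U, ‖F n w‖ ≤ g w)
    (hlim : ∀ w ∈ U, Tendsto (fun n => F n w) atTop (𝓝 (f w))) :
    Tendsto (fun n => deriv (F n) z) atTop (𝓝 (deriv f z)) := by
  have hmem : ∀ θ, circleMap z r θ ∈ U := fun θ =>
    hzr (circleMap_mem_closedBall z hr.le θ)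
  have hne : ∀ θ, circleMap z r θ - z ≠ 0 := fun θ =>
    sub_ne_zero.2 (circleMap_ne_center hr.ne')
  have hcont : ∀ {h : ℂ → ℂ}, DifferentiableOn ℂ h U →
      Continuous fun θ : ℝ => h (circleMap z r θ) := fun hh =>
    hh.continuousOn.comp_continuous (continuous_circleMap z r) hmem
  -- Cauchy's integral formula for the derivative reduces the claim to dominated convergence on the
  -- circle.
  simp_rw [← fun n => Complex.cderiv_eq_deriv hU (hF n) hr hzr,
    ← Complex.cderiv_eq_deriv hU hf hr hzr]
  unfold Complex.cderiv circleIntegral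
  refine Tendsto.const_smul ?_ _
  refine intervalIntegral.tendsto_integral_filter_of_dominated_convergence
    (fun θ => r * ((r ^ 2)⁻¹ * g (circleMap z r θ))) ?_ ?_ ?_ ?_
  · refine Eventually.of_forall fun n => Continuous.aestronglyMeasurable ?_
    simp only [deriv_circleMap]
    have h1 : Continuous fun θ : ℝ => ((circleMap z r θ - z) ^ 2)⁻¹ :=
      (((continuous_circleMap z r).sub continuous_const).pow 2).inv₀ fun θ => pow_ne_zero 2 (hne θ)
    exact ((continuous_circleMap 0 r).mul continuous_const).smul (h1.smul (hcont (hF n)))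
  · filter_upwards [hFg] with n hn
    refine Eventually.of_forall fun θ _ => ?_
    have h1 : ‖circleMap z r θ - z‖ = r := by simp [circleMap, abs_of_pos hr]
    rw [norm_smul, norm_smul, norm_inv, norm_pow, h1, deriv_circleMap]
    have h2 : ‖circleMap 0 r θ * Complex.I‖ = r := by simp [circleMap, abs_of_pos hr]
    rw [h2]
    have := hn _ (hmem θ)
    gcongr
  · refine Continuous.intervalIntegrable ?_ _ _
    exact continuous_const.mul (continuous_const.mul
      (hg.comp_continuous (continuous_circleMap z r) hmem))
  · exact Eventually.of_forall fun θ _ => ((hlim _ (hmem θ)).const_smul _).const_smul _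

/-- The left side has logarithmic derivative log n − ψ(s+n+1), while the right side tends to 1.
Differentiating the limit gives `tendsto_log_sub_digamma`. -/
theorem cpow_mul_factorial_div_Gamma {s : ℂ} (hs : 0 < s.re) (n : ℕ) :
    (n : ℂ) ^ s * n.factorial * (Complex.Gamma (s + (n + 1 : ℕ)))⁻¹ =
      Complex.GammaSeq s n / Complex.Gamma s := by
  have h1 := Complex.Gamma_ne_zero_of_re_pos hs
  have h2 : Complex.Gamma (s + (n + 1 : ℕ)) ≠ 0 :=
    Complex.Gamma_ne_zero_of_re_pos (by simp; positivity)
  have h3 : poch s (n + 1) ≠ 0 := poch_ne_zero (ne_neg_nat_of_re_pos hs) _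
  have h4 : Complex.Gamma (s + (n + 1 : ℕ)) = poch s (n + 1) * Complex.Gamma s := by
    rw [poch, ← Complex.Gamma_add_nat_div_Gamma_eq s (ne_neg_nat_of_re_pos hs), div_mul_cancel₀ _ h1]
  rw [Complex.GammaSeq, ← poch_eq_prod, h4]
  field_simp

theorem tendsto_log_sub_digamma {z : ℂ} (hz : 0 < z.re) :
    Tendsto (fun n : ℕ => Complex.log n - Complex.digamma (z + (n + 1 : ℕ))) atTop (𝓝 0) := by
  -- The index is shifted to n+1 so that the base of the power is nonzero.
  set F : ℕ → ℂ → ℂ := fun n w =>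
    ((n + 1 : ℕ) : ℂ) ^ w * (n + 1).factorial * (Complex.Gamma (w + (n + 1 + 1 : ℕ)))⁻¹ with hFdef
  set U : Set ℂ := {w | 0 < w.re} with hUdef
  have hU : IsOpen U := isOpen_lt continuous_const Complex.continuous_re
  have hFeq : ∀ n, ∀ w ∈ U, F n w = Complex.GammaSeq w (n + 1) / Complex.Gamma w := fun n w hw =>
    cpow_mul_factorial_div_Gamma hw (n + 1)
  have hlim : ∀ w ∈ U, Tendsto (fun n => F n w) atTop (𝓝 1) := fun w hw => by
    have h0 := Complex.Gamma_ne_zero_of_re_pos hw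
    simp_rw [fun n => hFeq n w hw]
    rw [← div_self h0]
    exact ((tendsto_add_atTop_iff_nat 1).2 (Complex.GammaSeq_tendsto_Gamma w)).div_const _
  have hFd : ∀ n, Differentiable ℂ (F n) := fun n => by
    have h1 : Differentiable ℂ fun w : ℂ => ((n + 1 : ℕ) : ℂ) ^ w := fun w =>
      DifferentiableAt.const_cpow differentiableAt_id (Or.inl (Nat.cast_ne_zero.2 n.succ_ne_zero))
    have h2 : Differentiable ℂ fun w : ℂ => (Complex.Gamma (w + (n + 1 + 1 : ℕ)))⁻¹ :=
      Complex.differentiable_one_div_Gamma.comp (differentiable_id.add_const _)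
    exact (h1.mul_const _).mul h2
  have hzr : Metric.closedBall z (z.re / 2) ⊆ U := fun w hw => by
    have h1 : ‖w - z‖ ≤ z.re / 2 := by simpa [dist_eq_norm] using hw
    have h2 := (abs_le.1 ((Complex.abs_re_le_norm (w - z)).trans h1)).1
    simp only [Complex.sub_re] at h2
    simp only [hUdef, Set.mem_ofPred_eq]
    linarith
  have hd := tendsto_deriv_of_dominated (f := fun _ => 1) hU (half_pos hz) hzr
    (fun n => (hFd n).differentiableOn) (differentiableOn_const 1)
    (g := fun w => Real.Gamma w.re / ‖Complex.Gamma w‖) ?_ ?_ hlim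
  · have h1 := hd.div (hlim z hz) one_ne_zero
    simp only [deriv_const, zero_div] at h1
    rw [← tendsto_add_atTop_iff_nat 1]
    refine h1.congr fun n => ?_
    have hn0 : ((n + 1 : ℕ) : ℂ) ≠ 0 := Nat.cast_ne_zero.2 n.succ_ne_zero
    have hre : 0 < (z + (n + 1 + 1 : ℕ)).re := by
      simp only [Complex.add_re, Complex.natCast_re]; positivity
    have hG := Complex.Gamma_ne_zero_of_re_pos hre
    have hGd := (Complex.differentiableAt_Gamma _ (ne_neg_nat_of_re_pos hre)).hasDerivAt
    have hf : (((n + 1).factorial : ℕ) : ℂ) ≠ 0 := Nat.cast_ne_zero.2 (Nat.factorial_ne_zero _)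
    have hpow : ((n + 1 : ℕ) : ℂ) ^ z ≠ 0 := by simp [Complex.cpow_eq_zero_iff, -Nat.cast_add, hn0]
    have D := (((hasDerivAt_id z).const_cpow (c := ((n + 1 : ℕ) : ℂ)) (Or.inl hn0)).mul_const
      (((n + 1).factorial : ℕ) : ℂ)).mul (((hGd.comp_add_const z _)).inv hG)
    have D' : deriv (F n) z = _ := D.deriv
    rw [Pi.div_apply, D', Complex.digamma_def, logDeriv_apply]
    simp only [hFdef, id, mul_one, Pi.inv_apply]
    field_simp
    ring
  · intro w hw
    have h0 := Complex.Gamma_ne_zero_of_re_pos hw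
    have h1 := (Complex.differentiableAt_Gamma w (ne_neg_nat_of_re_pos hw)).continuousAt
    have h2 : ContinuousAt Real.Gamma w.re := (Real.differentiableAt_Gamma fun m h => by
      have : (0 : ℝ) ≤ m := m.cast_nonneg
      have hw' : 0 < w.re := hw
      linarith).continuousAt
    exact ((h2.comp Complex.continuous_re.continuousAt).div h1.norm
      (norm_ne_zero_iff.2 h0)).continuousWithinAt
  · refine Eventually.of_forall fun n w hw => ?_
    rw [hFeq n w hw, norm_div]
    gcongr
    exact norm_GammaSeq_le hw n.succ_ne_zero

theorem tendsto_digamma_sub_digamma {x y : ℂ} (hx : 0 < x.re) (hy : 0 < y.re) :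
    Tendsto (fun n : ℕ => Complex.digamma (x + n) - Complex.digamma (y + n)) atTop (𝓝 0) := by
  rw [← tendsto_add_atTop_iff_nat 1]
  have := (tendsto_log_sub_digamma hy).sub (tendsto_log_sub_digamma hx)
  simpa using this

/-! ### Reflection formula for ψ. -/

theorem sin_pi_mul_ne_zero_of_forall_ne_int {z : ℂ} (hz : ∀ m : ℤ, z ≠ m) :
    Complex.sin (Real.pi * z) ≠ 0 := by
  rw [Ne, Complex.sin_eq_zero_iff]
  rintro ⟨k, hk⟩
  rw [mul_comm] at hk
  exact hz k (mul_right_cancel₀ (Complex.ofReal_ne_zero.2 Real.pi_ne_zero) hk)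

/-- Differentiate Γ(w)Γ(1−w) sin(πw) = π, which holds near `z`. -/
theorem digamma_one_sub_sub_digamma {z : ℂ} (hz : ∀ m : ℤ, z ≠ m) :
    Complex.digamma (1 - z) - Complex.digamma z =
      Real.pi * (Complex.cos (Real.pi * z) / Complex.sin (Real.pi * z)) := by
  have hs : Complex.sin (Real.pi * z) ≠ 0 :=
    sin_pi_mul_ne_zero_of_forall_ne_int hz
  have h1 : ∀ m : ℕ, z ≠ -m := fun m h => hz (-m) (by simpa using h)
  have h2 : ∀ m : ℕ, 1 - z ≠ -m := fun m h => hz (m + 1) (by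
    push_cast; linear_combination -h)
  have G1 := Complex.Gamma_ne_zero h1
  have G2 := Complex.Gamma_ne_zero h2
  have D1 := (Complex.differentiableAt_Gamma z h1).hasDerivAt
  have D2 := (Complex.differentiableAt_Gamma (1 - z) h2).hasDerivAt.comp_const_sub 1 z
  have D3 := (D1.mul D2).mul
    ((Complex.hasDerivAt_sin (Real.pi * z)).comp z ((hasDerivAt_id z).const_mul (Real.pi : ℂ)))
  have hpi : ∀ᶠ w in 𝓝 z, Complex.Gamma w * Complex.Gamma (1 - w) *
      Complex.sin (Real.pi * w) = Real.pi := by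
    have hc : ContinuousAt (fun w : ℂ => Complex.sin (Real.pi * w)) z := by fun_prop
    filter_upwards [hc.eventually_ne hs] with w hw
    rw [Complex.Gamma_mul_Gamma_one_sub, div_mul_cancel₀ _ hw]
  have D4 := (hasDerivAt_const z (Real.pi : ℂ)).congr_of_eventuallyEq hpi
  have e := D3.unique D4
  simp only [Complex.digamma_def, logDeriv_apply]
  simp only [Function.comp, mul_one, Pi.mul_apply] at e
  generalize Complex.sin (Real.pi * z) = t at hs e ⊢
  generalize Complex.cos (Real.pi * z) = u at e ⊢
  field_simp
  linear_combination -e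

/-! ### Uniqueness by integer shifts, and the auxiliary series. -/

theorem eq_zero_of_tendsto_of_forall_succ_eq {f : ℕ → ℂ} (h : ∀ n, f (n + 1) = f n)
    (hf : Tendsto f atTop (𝓝 0)) : f 0 = 0 := by
  have h1 : ∀ n, f n = f 0 := fun n => by
    induction n with
    | zero => rfl
    | succ n ih => rw [h, ih]
  exact tendsto_nhds_unique (tendsto_const_nhds.congr fun n => (h1 n).symm) hf

theorem keyTerm_succ (a b c : ℂ) (n : ℕ) :
    keyTerm a b c (n + 1) = gaussTerm a (1 - b) (1 + c - b) (n + 1) / (n + 1 : ℕ) := by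
  rw [keyTerm, gaussTerm, div_div]
  congr 1
  ring

/-- The last factor is 1/(n+1) + 1/x. Raising the lower parameter thus gives absolute convergence
under the weaker condition on x+1, and in `tsum_gaussTerm_div_sub` the 1/(n+1) parts cancel, leaving
a Gauss sum divided by `x`. -/
theorem gaussTerm_div_eq (a b : ℂ) {x : ℂ} (hx : 0 < x.re) (n : ℕ) :
    gaussTerm a b x (n + 1) / (n + 1 : ℕ) =
      gaussTerm a b (x + 1) (n + 1) * ((x + (n + 1 : ℕ)) / (x * (n + 1 : ℕ))) := by
  have hx' := ne_neg_nat_of_re_pos hx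
  have h0 : x ≠ 0 := by simpa using hx' 0
  have h1 : ((n + 1 : ℕ) : ℂ) ≠ 0 := Nat.cast_ne_zero.2 n.succ_ne_zero
  have e := gaussTerm_add_one_right a b hx' (n + 1)
  field_simp
  linear_combination -e

theorem summable_norm_gaussTerm_div (a b : ℂ) {x : ℂ} (hx : 0 < x.re)
    (h : 0 < (x + 1 - a - b).re) :
    Summable fun n : ℕ => ‖gaussTerm a b x (n + 1) / (n + 1 : ℕ)‖ := by
  have hx1 : ∀ m : ℕ, x + 1 ≠ -m := ne_neg_nat_of_re_pos (by simp; linarith)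
  have s := ((summable_nat_add_iff 1).2 (summable_norm_gaussTerm a b hx1 h)).mul_right
    (1 + 1 / ‖x‖)
  refine Summable.of_nonneg_of_le (fun _ => norm_nonneg _) (fun n => ?_) s
  have h0 : x ≠ 0 := by simpa using ne_neg_nat_of_re_pos hx 0
  have h1 : ((n + 1 : ℕ) : ℂ) ≠ 0 := Nat.cast_ne_zero.2 n.succ_ne_zero
  rw [gaussTerm_div_eq a b hx, norm_mul]
  gcongr
  rw [show (x + (n + 1 : ℕ)) / (x * (n + 1 : ℕ)) = 1 / ((n + 1 : ℕ) : ℂ) + 1 / x by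
    field_simp]
  refine (norm_add_le _ _).trans ?_
  rw [norm_div, norm_div, norm_one, Complex.norm_natCast]
  gcongr
  rw [div_le_one (by positivity)]
  push_cast
  linarith [(n.cast_nonneg : (0 : ℝ) ≤ n)]

theorem tsum_gaussTerm_div_sub (a b : ℂ) {x : ℂ} (hx : 0 < x.re) (h : 0 < (x + 1 - a - b).re) :
    ∑' n : ℕ, gaussTerm a b x (n + 1) / (n + 1 : ℕ) -
        ∑' n : ℕ, gaussTerm a b (x + 1) (n + 1) / (n + 1 : ℕ) =
      (∑' n, gaussTerm a b (x + 1) n - 1) / x := by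
  have hx1 : 0 < (x + 1).re := by simp; linarith
  have h0 : x ≠ 0 := by simpa using ne_neg_nat_of_re_pos hx 0
  have s1 := (summable_norm_gaussTerm_div a b hx h).of_norm
  have s2 := (summable_norm_gaussTerm_div a b hx1 (by simp at h ⊢; linarith)).of_norm
  have s3 := (summable_norm_gaussTerm a b (ne_neg_nat_of_re_pos hx1) h).of_norm
  rw [← s1.tsum_sub s2, s3.tsum_eq_zero_add, gaussTerm_zero, add_sub_cancel_left, ← tsum_div_const]
  refine tsum_congr fun n => ?_
  have h1 : ((n + 1 : ℕ) : ℂ) ≠ 0 := Nat.cast_ne_zero.2 n.succ_ne_zero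
  rw [gaussTerm_div_eq a b hx]
  field_simp
  ring

theorem tendsto_tsum_gaussTerm_div (a b : ℂ) {x : ℂ} (hx : 0 < x.re)
    (h : 0 < (x + 1 - a - b).re) :
    Tendsto (fun N : ℕ => ∑' n : ℕ, gaussTerm a b (x + N) (n + 1) / (n + 1 : ℕ)) atTop (𝓝 0) := by
  have s1 := summable_norm_gaussTerm_div a b hx h
  refine tendsto_zero_of_natCast_mul_le
    (C := ‖x‖ * ∑' n : ℕ, ‖gaussTerm a b x (n + 1) / (n + 1 : ℕ)‖) fun N => ?_
  have hN : (0 : ℝ) ≤ N := N.cast_nonneg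
  have s2 := summable_norm_gaussTerm_div a b (x := x + N) (by simp; linarith)
    (by simp at h ⊢; linarith)
  rw [← tsum_mul_left]
  calc _ ≤ N * ∑' n : ℕ, ‖gaussTerm a b (x + N) (n + 1) / (n + 1 : ℕ)‖ := by
        gcongr; exact norm_tsum_le_tsum_norm s2
    _ = ∑' n : ℕ, N * ‖gaussTerm a b (x + N) (n + 1) / (n + 1 : ℕ)‖ := tsum_mul_left.symm
    _ ≤ _ := (s2.mul_left _).tsum_le_tsum (fun n => ?_) (s1.mul_left _)
  have := natCast_mul_norm_gaussTerm_le a b hx N n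
  rw [norm_div, norm_div, ← mul_div_assoc, ← mul_div_assoc]
  gcongr

/-- Replace the lower parameter 1 by 1+N. By Gauss' theorem the sum and ψ(1+N) − ψ(1−a+N) have the
same increments in `N`, and both tend to 0; the claim is the case N = 0. -/
theorem tsum_gaussTerm_one_div {a : ℂ} (ha : a.re < 1) :
    ∑' n : ℕ, gaussTerm a 1 1 (n + 1) / (n + 1 : ℕ) =
      -(Real.eulerMascheroniConstant : ℂ) - Complex.digamma (1 - a) := by
  have h1 : (0 : ℝ) < (1 : ℂ).re := by simp
  have h2 : 0 < (1 - a).re := by simp; linarith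
  have key := eq_zero_of_tendsto_of_forall_succ_eq (f := fun N : ℕ =>
    ∑' n : ℕ, gaussTerm a 1 (1 + N) (n + 1) / (n + 1 : ℕ) -
      (Complex.digamma (1 + N) - Complex.digamma (1 - a + N))) ?_ ?_
  · simp only [Nat.cast_zero, add_zero, Complex.digamma_one] at key
    linear_combination key
  · intro N
    have hN : (0 : ℝ) ≤ N := N.cast_nonneg
    have hx : 0 < (1 + (N : ℂ)).re := by simp; linarith
    have hy : 0 < (1 - a + N).re := by simp; linarith
    have hz : 0 < (1 + (N : ℂ) + 1 - a - 1).re := by simp; linarith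
    have hx1 : 0 < (1 + (N : ℂ) + 1).re := by simp; linarith
    have e := tsum_gaussTerm_div_sub a 1 hx hz
    rw [tsum_gaussTerm a 1 hx1 hz] at e
    have hx0 : 1 + (N : ℂ) ≠ 0 := by simpa using ne_neg_nat_of_re_pos hx 0
    have hy0 : 1 - a + (N : ℂ) ≠ 0 := by simpa using ne_neg_nat_of_re_pos hy 0
    rw [show 1 + (N : ℂ) + 1 - a - 1 = 1 - a + N by ring,
      show 1 + (N : ℂ) + 1 - a = 1 - a + N + 1 by ring, add_sub_cancel_right,
      Complex.Gamma_add_one _ hx0, Complex.Gamma_add_one _ hy0] at e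
    have g1 := Complex.Gamma_ne_zero_of_re_pos hx
    have g2 := Complex.Gamma_ne_zero_of_re_pos hy
    have e2 : ((1 + (N : ℂ)) * Complex.Gamma (1 + N) * Complex.Gamma (1 - a + N) /
        ((1 - a + N) * Complex.Gamma (1 - a + N) * Complex.Gamma (1 + N)) - 1) / (1 + N) =
        (1 - a + (N : ℂ))⁻¹ - (1 + (N : ℂ))⁻¹ := by
      field_simp
    rw [e2] at e
    have d1 := Complex.digamma_apply_add_one _ (ne_neg_nat_of_re_pos hx)
    have d2 := Complex.digamma_apply_add_one _ (ne_neg_nat_of_re_pos hy)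
    push_cast
    rw [← add_assoc, ← add_assoc, d1, d2]
    push_cast at e
    linear_combination -e
  · simpa using (tendsto_tsum_gaussTerm_div a 1 h1 (by simp; linarith)).sub
      (tendsto_digamma_sub_digamma h1 h2)

/-! ### The series ₃F₂(a, b, c; a+b, 1+c; 1) as a function of c. -/

theorem hyp3F2Term_zero (a b c d e z : ℂ) : hyp3F2Term a b c d e z 0 = 1 := by
  simp [hyp3F2Term, poch_zero]

/-- Since (c)_n/(1+c)_n = c/(c+n), the ₃F₂ is a Gauss series with weights c/(c+n). -/
theorem hyp3F2Term_succ (a b d : ℂ) {c : ℂ} (hc : ∀ m : ℕ, c + 1 ≠ -m) (n : ℕ) :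
    hyp3F2Term a b c d (1 + c) 1 (n + 1) =
      gaussTerm a b d (n + 1) * (c / (c + (n + 1 : ℕ))) := by
  have h1 := poch_ne_zero hc n
  have h2 : c + 1 + (n : ℂ) ≠ 0 := add_natCast_ne_zero hc n
  have e : c * poch (c + 1) n / (poch (c + 1) n * (c + 1 + n)) = c / (c + (n + 1 : ℕ)) := by
    rw [show c + ((n + 1 : ℕ) : ℂ) = c + 1 + n by push_cast; ring]
    field_simp
  rw [hyp3F2Term, gaussTerm, one_pow, mul_one, add_comm 1 c, poch_succ_left c, poch_succ (c + 1),
    ← e, div_mul_div_comm]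
  congr 1
  ring

theorem tendsto_nat_mul_gaussTerm_balanced (a b : ℂ) (h : ∀ m : ℕ, a + b ≠ -m) :
    Tendsto (fun n : ℕ => (n : ℂ) * gaussTerm a b (a + b) n) atTop
      (𝓝 (Complex.Gamma (a + b) / (Complex.Gamma a * Complex.Gamma b))) := by
  rw [← tendsto_add_atTop_iff_nat 1]
  have h1 := tendsto_gaussTerm a b h
  simp only [show a + b + 1 - a - b = 1 by ring, Complex.cpow_one] at h1
  have h2 : Tendsto (fun n : ℕ => 1 + 1 / (n : ℂ)) atTop (𝓝 1) := by
    simpa using (tendsto_const_div_atTop_nhds_zero_nat (1 : ℂ)).const_add 1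
  have h3 := h2.mul h1
  rw [one_mul] at h3
  refine h3.congr' ?_
  filter_upwards [eventually_ge_atTop 1] with n hn
  have hn0 : (n : ℂ) ≠ 0 := by exact_mod_cast (by omega : n ≠ 0)
  push_cast
  field_simp

theorem exists_norm_gaussTerm_balanced_le (a b : ℂ) (h : ∀ m : ℕ, a + b ≠ -m) :
    ∃ M : ℝ, 0 ≤ M ∧ ∀ n : ℕ, (n + 1 : ℕ) * ‖gaussTerm a b (a + b) (n + 1)‖ ≤ M := by
  obtain ⟨M, hM⟩ := (tendsto_nat_mul_gaussTerm_balanced a b h).norm.bddAbove_range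
  have hb : ∀ n : ℕ, (n : ℝ) * ‖gaussTerm a b (a + b) n‖ ≤ M := fun n => by
    simpa using hM (Set.mem_range_self n)
  exact ⟨M, by simpa using hb 0, fun n => hb (n + 1)⟩

/-- The bound −1/2 on Re c is what makes this hold already at n = 0. With t_n = O(1/n) it yields a
summable majorant of order 1/n², uniform in `N`. -/
theorem half_le_norm_add {c : ℂ} (hc : -(1 / 2) < c.re) (N n : ℕ) :
    ((n + 1 : ℕ) : ℝ) / 2 ≤ ‖c + N + (n + 1 : ℕ)‖ := by
  refine le_trans ?_ (Complex.re_le_norm _)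
  have : (0 : ℝ) ≤ n := n.cast_nonneg
  have : (0 : ℝ) ≤ N := N.cast_nonneg
  simp only [Complex.add_re, Complex.natCast_re]
  push_cast
  linarith

theorem summable_const_div_succ_sq (C : ℝ) : Summable fun n : ℕ => C / ((n + 1 : ℕ) : ℝ) ^ 2 := by
  have h := (summable_nat_add_iff 1).2 (Real.summable_one_div_nat_pow.2 one_lt_two)
  exact (h.mul_left C).congr fun n => by rw [mul_one_div]

theorem norm_gaussTerm_mul_div_le {u : ℂ} {M : ℝ} {n : ℕ} (hu : (n + 1 : ℕ) * ‖u‖ ≤ M)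
    {c : ℂ} (hc : -(1 / 2) < c.re) (N : ℕ) (w : ℂ) :
    ‖u * (w / (c + N + (n + 1 : ℕ)))‖ ≤ 2 * M * ‖w‖ / ((n + 1 : ℕ) : ℝ) ^ 2 := by
  have h1 := half_le_norm_add hc N n
  have hn : (0 : ℝ) < (n + 1 : ℕ) := by positivity
  have h2 : 0 < ‖c + N + (n + 1 : ℕ)‖ := lt_of_lt_of_le (by positivity) h1
  rw [norm_mul, norm_div, ← mul_div_assoc, div_le_div_iff₀ h2 (by positivity)]
  have hM : 0 ≤ M := le_trans (by positivity) hu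
  calc ‖u‖ * ‖w‖ * ((n + 1 : ℕ) : ℝ) ^ 2 = ‖w‖ * (((n + 1 : ℕ) * ‖u‖) * (n + 1 : ℕ)) := by ring
    _ ≤ ‖w‖ * (M * (2 * ‖c + N + (n + 1 : ℕ)‖)) := by gcongr; linarith
    _ = _ := by ring

theorem re_add_one_pos {c : ℂ} (hc : -(1 / 2) < c.re) : 0 < (c + 1).re := by
  simp; linarith

theorem summable_hyp3F2Term {a b : ℂ} (h : ∀ m : ℕ, a + b ≠ -m) {c : ℂ}
    (hc : -(1 / 2) < c.re) : Summable fun n => hyp3F2Term a b c (a + b) (1 + c) 1 n := by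
  obtain ⟨M, -, hM⟩ := exists_norm_gaussTerm_balanced_le a b h
  rw [← summable_nat_add_iff 1]
  refine Summable.of_norm_bounded (summable_const_div_succ_sq (2 * M * ‖c‖)) fun n => ?_
  rw [hyp3F2Term_succ a b _ (ne_neg_nat_of_re_pos (re_add_one_pos hc))]
  simpa using norm_gaussTerm_mul_div_le (hM n) hc 0 c

theorem hyp3F2_eq_one_add {a b : ℂ} (h : ∀ m : ℕ, a + b ≠ -m) {c : ℂ}
    (hc : -(1 / 2) < c.re) : hyp3F2 a b c (a + b) (1 + c) 1 =
      1 + ∑' n : ℕ, gaussTerm a b (a + b) (n + 1) * (c / (c + (n + 1 : ℕ))) := by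
  rw [hyp3F2, (summable_hyp3F2Term h hc).tsum_eq_zero_add, hyp3F2Term_zero]
  congr 1
  exact tsum_congr fun n =>
    hyp3F2Term_succ a b _ (ne_neg_nat_of_re_pos (re_add_one_pos hc)) n

theorem hyp3F2_zero (a b d e z : ℂ) : hyp3F2 a b 0 d e z = 1 := by
  rw [hyp3F2, tsum_eq_single 0, hyp3F2Term_zero]
  intro n hn
  obtain ⟨n, rfl⟩ := Nat.exists_eq_succ_of_ne_zero hn
  simp [hyp3F2Term, poch_succ_left 0]

theorem tendsto_div_add_natCast_add (w c : ℂ) (j : ℕ) :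
    Tendsto (fun N : ℕ => w / (c + N + j)) atTop (𝓝 0) := by
  have h : Tendsto (fun N : ℕ => c + (N : ℂ) + j) atTop (Bornology.cobounded ℂ) := by
    have := (tendsto_natCast_atTop_cobounded (α := ℂ))
    simp only [← tendsto_norm_atTop_iff_cobounded] at this ⊢
    refine tendsto_atTop_mono (fun N => ?_) (tendsto_atTop_add_const_right _ (-‖c + j‖) this)
    have := norm_sub_norm_le (N : ℂ) (-(c + j))
    rw [norm_neg, sub_neg_eq_add] at this
    rw [show c + (N : ℂ) + j = N + (c + j) by ring]
    linarith
  simpa [div_eq_mul_inv] using (tendsto_inv₀_cobounded.comp h).const_mul w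

/-- After division by `N` the weight N/(N+n) becomes 1/(N+n), which tends to 0 for each n; dominated
convergence applies. -/
theorem tendsto_hyp3F2_div {a b : ℂ} (h : ∀ m : ℕ, a + b ≠ -m) :
    Tendsto (fun N : ℕ => hyp3F2 a b N (a + b) (1 + N) 1 / N) atTop (𝓝 0) := by
  obtain ⟨M, -, hM⟩ := exists_norm_gaussTerm_balanced_le a b h
  have hlim := tendsto_tsum_of_dominated_convergence (𝓕 := atTop)
    (f := fun (N n : ℕ) => gaussTerm a b (a + b) (n + 1) * (1 / (0 + (N : ℂ) + (n + 1 : ℕ))))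
    (g := fun _ => 0) (summable_const_div_succ_sq (2 * M * ‖(1 : ℂ)‖))
    (fun n => by
      simpa using (tendsto_div_add_natCast_add 1 0 (n + 1)).const_mul
        (gaussTerm a b (a + b) (n + 1)))
    (Eventually.of_forall fun N n => norm_gaussTerm_mul_div_le (hM n) (by simp) N 1)
  have h2 := (tendsto_const_div_atTop_nhds_zero_nat (1 : ℂ)).add hlim
  rw [tsum_zero, add_zero] at h2
  refine h2.congr' ?_
  filter_upwards [eventually_ge_atTop 1] with N hN
  have hN0 : (N : ℂ) ≠ 0 := by exact_mod_cast (by omega : N ≠ 0)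
  have hre : -(1 / 2) < (N : ℂ).re := by
    have : (0 : ℝ) ≤ N := N.cast_nonneg
    simp; linarith
  rw [hyp3F2_eq_one_add h hre, add_div, ← tsum_div_const]
  congr 1
  refine tsum_congr fun n => ?_
  rw [zero_add]
  field_simp

/-- The two weights differ by c/(c+N+n) · n/(N+n). The first factor gives the summable majorant, and
the second has modulus at most 1. -/
theorem tendsto_hyp3F2_sub {a b : ℂ} (h : ∀ m : ℕ, a + b ≠ -m) {c : ℂ}
    (hc : -(1 / 2) < c.re) :
    Tendsto (fun N : ℕ => hyp3F2 a b (c + N) (a + b) (1 + (c + N)) 1 -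
      hyp3F2 a b N (a + b) (1 + N) 1) atTop (𝓝 0) := by
  obtain ⟨M, hM0, hM⟩ := exists_norm_gaussTerm_balanced_le a b h
  have hlim := tendsto_tsum_of_dominated_convergence (𝓕 := atTop)
    (f := fun (N n : ℕ) => gaussTerm a b (a + b) (n + 1) * (c / (c + N + (n + 1 : ℕ))) *
      ((n + 1 : ℕ) / (0 + (N : ℂ) + (n + 1 : ℕ))))
    (g := fun _ => 0) (summable_const_div_succ_sq (2 * M * ‖c‖))
    (fun n => by
      simpa using ((tendsto_div_add_natCast_add c c (n + 1)).const_mul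
        (gaussTerm a b (a + b) (n + 1))).mul
        (tendsto_div_add_natCast_add ((n + 1 : ℕ) : ℂ) 0 (n + 1)))
    (Eventually.of_forall fun N n => by
      rw [norm_mul]
      refine (mul_le_of_le_one_right (norm_nonneg _) ?_).trans
        (norm_gaussTerm_mul_div_le (hM n) hc N c)
      rw [zero_add, ← Nat.cast_add, norm_div, Complex.norm_natCast, Complex.norm_natCast]
      refine div_le_one_of_le₀ ?_ (Nat.cast_nonneg _)
      exact_mod_cast Nat.le_add_left _ _)
  rw [tsum_zero] at hlim
  refine hlim.congr fun N => ?_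
  have hN : (0 : ℝ) ≤ N := N.cast_nonneg
  have hre : -(1 / 2) < (N : ℂ).re := by simp; linarith
  have hre' : -(1 / 2) < (c + N : ℂ).re := by simp; linarith
  have s1 := (summable_nat_add_iff 1).2 (summable_hyp3F2Term h hre)
  have s2 := (summable_nat_add_iff 1).2 (summable_hyp3F2Term h hre')
  simp_rw [hyp3F2_eq_one_add h hre, hyp3F2_eq_one_add h hre', add_sub_add_left_eq_sub]
  simp_rw [hyp3F2Term_succ a b _ (ne_neg_nat_of_re_pos (re_add_one_pos hre))] at s1
  simp_rw [hyp3F2Term_succ a b _ (ne_neg_nat_of_re_pos (re_add_one_pos hre'))] at s2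
  rw [← s2.tsum_sub s1]
  refine tsum_congr fun n => ?_
  have n1 : (N : ℂ) + (n + 1 : ℕ) ≠ 0 := by exact_mod_cast (by omega : N + (n + 1) ≠ 0)
  have n2 : c + (N : ℂ) + (n + 1 : ℕ) ≠ 0 := norm_pos_iff.1
    (lt_of_lt_of_le (by positivity) (half_le_norm_add hc N n))
  rw [zero_add]
  field_simp
  ring

/-- The inhomogeneous recurrence in `c` for the balanced series `₃F₂(a, b, c; a + b, 1 + c; 1)`. -/
theorem hyp3F2_recurrence {a b : ℂ} (h : ∀ m : ℕ, a + b ≠ -m) {c : ℂ} (hc : -(1 / 2) < c.re) :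
    (c + 1 - a - b) * hyp3F2 a b c (a + b) (1 + c) 1 =
      (c + 1 - a) * (c + 1 - b) / (c + 1) * hyp3F2 a b (c + 1) (a + b) (1 + (c + 1)) 1 -
        Complex.Gamma (a + b) / (Complex.Gamma a * Complex.Gamma b) := by
  have hc1 : -(1 / 2) < (c + 1).re := by simp; linarith
  have hp := ne_neg_nat_of_re_pos (re_add_one_pos hc)
  have hp1 := ne_neg_nat_of_re_pos (re_add_one_pos hc1)
  have h0 : c + 1 ≠ 0 := by simpa using hp 0
  have hn : ∀ n : ℕ, c + (n + 1 : ℕ) ≠ 0 := fun n => by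
    have := add_natCast_ne_zero hp n
    rwa [show c + ((n + 1 : ℕ) : ℂ) = c + 1 + n by push_cast; ring]
  have s1 := summable_hyp3F2Term h hc
  have s2 := summable_hyp3F2Term h hc1
  have key := hasSum_of_eq_sub
    -- Telescoping certificate: it vanishes at n = 0, and its limit is that of n·t_n, which produces
    -- the inhomogeneous term.
    (v := fun n => (n : ℂ) * gaussTerm a b (a + b) n * ((n + a + b - 1) / (c + n)))
    (l := Complex.Gamma (a + b) / (Complex.Gamma a * Complex.Gamma b))
    ((s1.mul_left (c + 1 - a - b)).sub (s2.mul_left ((c + 1 - a) * (c + 1 - b) / (c + 1)))) ?_ ?_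
  · have e := key.unique ((s1.hasSum.mul_left _).sub (s2.hasSum.mul_left _))
    rw [Nat.cast_zero, zero_mul, zero_mul, zero_sub] at e
    rw [hyp3F2, hyp3F2]
    linear_combination -e
  · intro n
    have hrec := gaussTerm_succ a b h n
    cases n with
    -- Index 0 is treated apart because c + n may vanish there.
    | zero =>
      rw [gaussTerm_zero] at hrec
      simp only [hyp3F2Term_zero, Nat.cast_zero, zero_mul, zero_add, Nat.cast_one] at hrec ⊢
      field_simp
      linear_combination hrec
    | succ n =>
      rw [hyp3F2Term_succ a b _ hp, hyp3F2Term_succ a b _ hp1]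
      have n1 := hn n
      have n2 := hn (n + 1)
      rw [show c + ((n + 1 + 1 : ℕ) : ℂ) = c + 1 + (n + 1 : ℕ) by push_cast; ring] at n2 ⊢
      generalize gaussTerm a b (a + b) (n + 1 + 1) = u at hrec ⊢
      generalize gaussTerm a b (a + b) (n + 1) = t at hrec ⊢
      rw [show ((n + 1 + 1 : ℕ) : ℂ) = (n + 1 : ℕ) + 1 by push_cast; ring]
      generalize ((n + 1 : ℕ) : ℂ) = k at hrec n1 n2 ⊢
      field_simp
      linear_combination (c + k) * hrec
  · have h1 : Tendsto (fun n : ℕ => 1 + (a + b - 1 - c) / (c + n + (0 : ℕ))) atTop (𝓝 1) := by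
      simpa using (tendsto_div_add_natCast_add (a + b - 1 - c) c 0).const_add 1
    have h2 := (tendsto_nat_mul_gaussTerm_balanced a b h).mul h1
    rw [mul_one] at h2
    refine h2.congr' ?_
    filter_upwards [eventually_ge_atTop 1] with n hn1
    obtain ⟨k, rfl⟩ := Nat.exists_eq_succ_of_ne_zero (by omega : n ≠ 0)
    have := hn k
    rw [Nat.cast_zero, add_zero, Nat.succ_eq_add_one]
    congr 1
    field_simp
    ring

/-! ### The defect: periodicity, behaviour at infinity, value at c = 0. -/

/-- The factor `Γ(1+c) Γ(1+c-a-b) / (Γ(1+c-a) Γ(1+c-b))`. -/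
noncomputable def gammaRatio (a b c : ℂ) : ℂ :=
  Complex.Gamma (1 + c) * Complex.Gamma (1 + c - a - b) /
    (Complex.Gamma (1 + c - a) * Complex.Gamma (1 + c - b))

/-- The combination of digamma values and the auxiliary series that multiplies `gammaFactor`. -/
noncomputable def digammaBracket (a b c : ℂ) : ℂ :=
  Complex.digamma (1 + c - b) - Complex.digamma a - Complex.digamma b
    - (Real.eulerMascheroniConstant : ℂ) - ∑' n : ℕ, keyTerm a b c (n + 1)

/-- The defect, up to normalisation, of the evaluation of `₃F₂(a, b, c; a + b, 1 + c; 1)`. -/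
noncomputable def evaluationDefect (a b c : ℂ) : ℂ :=
  hyp3F2 a b c (a + b) (1 + c) 1 / gammaRatio a b c -
    Complex.Gamma (a + b) / (Complex.Gamma a * Complex.Gamma b) * digammaBracket a b c

theorem gammaFactor_eq (a b c : ℂ) : gammaFactor a b c =
    Complex.Gamma (a + b) / (Complex.Gamma a * Complex.Gamma b) * gammaRatio a b c := by
  rw [gammaFactor, gammaRatio, div_mul_div_comm]
  congr 1 <;> ring

/-- The parameter range in which all Gamma factors have arguments with positive real part. -/
structure Admissible (a b c : ℂ) : Prop where
  re_c : -(1 / 2) < c.re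
  re_sub_left : 0 < (1 + c - a).re
  re_sub_right : 0 < (1 + c - b).re
  re_sub_sub : 0 < (1 + c - a - b).re

theorem Admissible.re_one_add {a b c : ℂ} (h : Admissible a b c) : 0 < (1 + c).re := by
  have := h.re_c
  simp; linarith

theorem Admissible.add_nat {a b c : ℂ} (h : Admissible a b c) (N : ℕ) :
    Admissible a b (c + N) := by
  obtain ⟨h1, h2, h3, h4⟩ := h
  have hN : (0 : ℝ) ≤ N := N.cast_nonneg
  constructor <;> simp at h1 h2 h3 h4 ⊢ <;> linarith

theorem Admissible.gammaRatio_ne_zero {a b c : ℂ} (h : Admissible a b c) :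
    gammaRatio a b c ≠ 0 :=
  div_ne_zero (mul_ne_zero (Complex.Gamma_ne_zero_of_re_pos h.re_one_add)
    (Complex.Gamma_ne_zero_of_re_pos h.re_sub_sub))
    (mul_ne_zero (Complex.Gamma_ne_zero_of_re_pos h.re_sub_left)
      (Complex.Gamma_ne_zero_of_re_pos h.re_sub_right))

/-- Gauss' theorem read backwards: the asymptotics of the Gamma quotient come from the series,
without Stirling's formula. -/
theorem Admissible.gammaRatio_eq_tsum {a b c : ℂ} (h : Admissible a b c) :
    gammaRatio a b c = ∑' n, gaussTerm a b (1 + c) n :=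
  (tsum_gaussTerm a b h.re_one_add h.re_sub_sub).symm

theorem ne_zero_of_re_pos {z : ℂ} (hz : 0 < z.re) : z ≠ 0 := by
  simpa using ne_neg_nat_of_re_pos hz 0

theorem Admissible.gammaRatio_add_one {a b c : ℂ} (h : Admissible a b c) :
    gammaRatio a b (c + 1) * ((1 + c - a) * (1 + c - b)) =
      gammaRatio a b c * ((1 + c) * (1 + c - a - b)) := by
  have n1 := ne_zero_of_re_pos h.re_sub_left
  have n2 := ne_zero_of_re_pos h.re_sub_right
  have g1 := Complex.Gamma_ne_zero_of_re_pos h.re_sub_left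
  have g2 := Complex.Gamma_ne_zero_of_re_pos h.re_sub_right
  rw [gammaRatio, gammaRatio, show 1 + (c + 1) = 1 + c + 1 by ring,
    show 1 + c + 1 - a - b = 1 + c - a - b + 1 by ring, show 1 + c + 1 - a = 1 + c - a + 1 by ring,
    show 1 + c + 1 - b = 1 + c - b + 1 by ring,
    Complex.Gamma_add_one _ (ne_zero_of_re_pos h.re_one_add),
    Complex.Gamma_add_one _ (ne_zero_of_re_pos h.re_sub_sub),
    Complex.Gamma_add_one _ n1, Complex.Gamma_add_one _ n2]
  field_simp

theorem Admissible.re_key {a b c : ℂ} (h : Admissible a b c) :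
    0 < (1 + c - b + 1 - a - (1 - b)).re := by
  rw [show 1 + c - b + 1 - a - (1 - b) = 1 + c - a by ring]
  exact h.re_sub_left

theorem Admissible.summable_keyTerm {a b c : ℂ} (h : Admissible a b c) :
    Summable fun n : ℕ => keyTerm a b c (n + 1) := by
  simp_rw [keyTerm_succ]
  exact (summable_norm_gaussTerm_div a (1 - b) h.re_sub_right h.re_key).of_norm

/-- The increment of the auxiliary series is a Gauss sum minus 1, divided by 1+c−b. The −1 cancels
against the increment 1/(1+c−b) of ψ, and the Gauss sum is a multiple of 1/`gammaRatio`. -/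
theorem Admissible.digammaBracket_add_one {a b c : ℂ} (h : Admissible a b c) :
    digammaBracket a b (c + 1) - digammaBracket a b c =
      1 / ((1 + c - a - b) * gammaRatio a b c) := by
  have hx1 : 0 < (1 + c - b + 1).re := by
    have := h.re_sub_right
    simp at this ⊢; linarith
  have n1 := ne_zero_of_re_pos h.re_sub_right
  have n2 := ne_zero_of_re_pos h.re_sub_sub
  have g1 := Complex.Gamma_ne_zero_of_re_pos h.re_sub_left
  have g2 := Complex.Gamma_ne_zero_of_re_pos h.re_sub_right
  have g3 := Complex.Gamma_ne_zero_of_re_pos h.re_sub_sub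
  have g4 := Complex.Gamma_ne_zero_of_re_pos h.re_one_add
  have e := tsum_gaussTerm_div_sub a (1 - b) h.re_sub_right h.re_key
  have d := Complex.digamma_apply_add_one _ (ne_neg_nat_of_re_pos h.re_sub_right)
  rw [tsum_gaussTerm a (1 - b) hx1 h.re_key,
    show 1 + c - b + 1 - a - (1 - b) = 1 + c - a by ring,
    show 1 + c - b + 1 - a = 1 + c - a - b + 1 by ring,
    show 1 + c - b + 1 - (1 - b) = 1 + c by ring, Complex.Gamma_add_one _ n1,
    Complex.Gamma_add_one _ n2] at e
  have e2 : 1 / ((1 + c - a - b) * gammaRatio a b c) =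
      ((1 + c - b) * Complex.Gamma (1 + c - b) * Complex.Gamma (1 + c - a) /
        ((1 + c - a - b) * Complex.Gamma (1 + c - a - b) * Complex.Gamma (1 + c)) - 1) /
        (1 + c - b) + (1 + c - b)⁻¹ := by
    rw [gammaRatio]
    generalize Complex.Gamma (1 + c - b) = y at *
    generalize Complex.Gamma (1 + c - a) = w at *
    generalize Complex.Gamma (1 + c - a - b) = u at *
    generalize Complex.Gamma (1 + c) = v at *
    field_simp
    ring
  rw [e2, ← e]
  simp_rw [digammaBracket, keyTerm_succ]
  rw [show 1 + (c + 1) - b = 1 + c - b + 1 by ring, d]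
  ring

theorem Admissible.evaluationDefect_add_one {a b c : ℂ} (h : Admissible a b c)
    (hab : ∀ m : ℕ, a + b ≠ -m) : evaluationDefect a b (c + 1) = evaluationDefect a b c := by
  have hrec := hyp3F2_recurrence hab h.re_c
  have hb := h.digammaBracket_add_one
  have hq := h.gammaRatio_add_one
  have q0 := h.gammaRatio_ne_zero
  have q1 : gammaRatio a b (c + 1) ≠ 0 := by simpa using (h.add_nat 1).gammaRatio_ne_zero
  have n0 := ne_zero_of_re_pos h.re_one_add
  have n1 := ne_zero_of_re_pos h.re_sub_left
  have n2 := ne_zero_of_re_pos h.re_sub_right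
  have n3 := ne_zero_of_re_pos h.re_sub_sub
  simp only [evaluationDefect]
  rw [show c + 1 = 1 + c by ring] at hrec hb hq q1 ⊢
  generalize hyp3F2 a b c (a + b) (1 + c) 1 = F at *
  generalize hyp3F2 a b (1 + c) (a + b) (1 + (1 + c)) 1 = F' at *
  generalize Complex.Gamma (a + b) / (Complex.Gamma a * Complex.Gamma b) = K at *
  rw [eq_add_of_sub_eq hb]
  generalize gammaRatio a b (1 + c) = q' at *
  generalize gammaRatio a b c = q at *
  have e1 : F' / q' = F' * ((1 + c - a) * (1 + c - b)) / (q * ((1 + c) * (1 + c - a - b))) := by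
    rw [← hq]; field_simp
  rw [e1]
  field_simp at hrec ⊢
  linear_combination -hrec

theorem ne_intCast_of_abs_re_lt_one {z : ℂ} (hz : |z.re| < 1) (h0 : z ≠ 0) (m : ℤ) : z ≠ m := by
  rintro rfl
  rw [Complex.intCast_re] at hz
  have : |m| < 1 := by exact_mod_cast hz
  exact h0 (by simpa using Int.abs_lt_one_iff.1 this)

theorem tsum_keyTerm_zero {a b : ℂ} (ha : a.re < 1) (hb : b.re < 1) :
    ∑' n : ℕ, keyTerm a b 0 (n + 1) =
      -(Real.eulerMascheroniConstant : ℂ) - Complex.digamma (1 - a) := by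
  rw [← tsum_gaussTerm_one_div ha]
  refine tsum_congr fun n => ?_
  have h1 : poch (1 - b) (n + 1) ≠ 0 :=
    poch_ne_zero (ne_neg_nat_of_re_pos (by simp; linarith)) _
  have hf : ((n + 1).factorial : ℂ) ≠ 0 := Nat.cast_ne_zero.2 (Nat.factorial_ne_zero _)
  have hn : ((n + 1 : ℕ) : ℂ) ≠ 0 := Nat.cast_ne_zero.2 n.succ_ne_zero
  rw [keyTerm_succ, add_zero, gaussTerm, gaussTerm, poch_one]
  field_simp

/-- The bracket equals ψ(1−a) − ψ(a) + ψ(1−b) − ψ(b) = π(cot πa + cot πb) = π sin π(a+b)/(sin πa sin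
πb). The bounds on real parts together with nonvanishing keep `a`, `b`, `a + b` off the integers. -/
theorem evaluationDefect_zero {a b : ℂ} (ha : |a.re| < 1) (hb : |b.re| < 1)
    (hab : |(a + b).re| < 1) (ha0 : a ≠ 0) (hb0 : b ≠ 0) (hab0 : a + b ≠ 0) :
    evaluationDefect a b 0 = 0 := by
  have ia := ne_intCast_of_abs_re_lt_one ha ha0
  have ib := ne_intCast_of_abs_re_lt_one hb hb0
  have iab := ne_intCast_of_abs_re_lt_one hab hab0
  have sa := sin_pi_mul_ne_zero_of_forall_ne_int ia
  have sb := sin_pi_mul_ne_zero_of_forall_ne_int ib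
  have sab := sin_pi_mul_ne_zero_of_forall_ne_int iab
  have hpi : (Real.pi : ℂ) ≠ 0 := Complex.ofReal_ne_zero.2 Real.pi_ne_zero
  have ra := Complex.Gamma_mul_Gamma_one_sub a
  have rb := Complex.Gamma_mul_Gamma_one_sub b
  have rab := Complex.Gamma_mul_Gamma_one_sub (a + b)
  have ca := digamma_one_sub_sub_digamma ia
  have cb := digamma_one_sub_sub_digamma ib
  have hB : digammaBracket a b 0 =
      Real.pi * (Complex.cos (Real.pi * a) / Complex.sin (Real.pi * a)) +
        Real.pi * (Complex.cos (Real.pi * b) / Complex.sin (Real.pi * b)) := by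
    rw [digammaBracket, tsum_keyTerm_zero (abs_lt.1 ha).2 (abs_lt.1 hb).2, ← ca, ← cb, add_zero]
    ring
  have hq : (gammaRatio a b 0)⁻¹ = Complex.Gamma (1 - a) * Complex.Gamma (1 - b) /
      Complex.Gamma (1 - (a + b)) := by
    rw [gammaRatio, add_zero, Complex.Gamma_one, one_mul, inv_div, sub_sub]
  have hsin : Complex.sin (Real.pi * (a + b)) =
      Complex.sin (Real.pi * a) * Complex.cos (Real.pi * b) +
        Complex.cos (Real.pi * a) * Complex.sin (Real.pi * b) := by
    rw [mul_add, Complex.sin_add]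
  have g1 : Complex.Gamma a ≠ 0 := fun h => by
    rw [h, zero_mul] at ra; exact div_ne_zero hpi sa ra.symm
  have g2 : Complex.Gamma b ≠ 0 := fun h => by
    rw [h, zero_mul] at rb; exact div_ne_zero hpi sb rb.symm
  have g3 : Complex.Gamma (1 - (a + b)) ≠ 0 := fun h => by
    rw [h, mul_zero] at rab; exact div_ne_zero hpi sab rab.symm
  rw [evaluationDefect, hyp3F2_zero, one_div, hq, hB]
  generalize Complex.sin (Real.pi * (a + b)) = t at *
  generalize Complex.sin (Real.pi * a) = s at *
  generalize Complex.sin (Real.pi * b) = u at *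
  generalize Complex.cos (Real.pi * a) = v at *
  generalize Complex.cos (Real.pi * b) = w at *
  have e1 : (Real.pi : ℂ) * (v / s) + Real.pi * (w / u) = Real.pi * t / (s * u) := by
    rw [hsin]; field_simp; ring
  have e2 : Complex.Gamma (a + b) = Real.pi / t / Complex.Gamma (1 - (a + b)) := by
    rw [← rab]; field_simp
  have e3 : Complex.Gamma (1 - a) = Real.pi / s / Complex.Gamma a := by
    rw [← ra]; field_simp
  have e4 : Complex.Gamma (1 - b) = Real.pi / u / Complex.Gamma b := by
    rw [← rb]; field_simp
  rw [e1, e2, e3, e4]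
  field_simp
  ring

theorem Admissible.tendsto_gammaRatio {a b c : ℂ} (h : Admissible a b c) :
    Tendsto (fun N : ℕ => gammaRatio a b (c + N)) atTop (𝓝 1) := by
  refine (tendsto_tsum_gaussTerm a b h.re_one_add h.re_sub_sub).congr fun N => ?_
  rw [(h.add_nat N).gammaRatio_eq_tsum, add_assoc]

/-- A product of o(N) and O(1/N). -/
theorem Admissible.tendsto_hyp3F2_mul_gammaRatio_sub_one {a b c : ℂ} (h : Admissible a b c)
    (hab : ∀ m : ℕ, a + b ≠ -m) :
    Tendsto (fun N : ℕ => hyp3F2 a b N (a + b) (1 + N) 1 * (gammaRatio a b (c + N) - 1))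
      atTop (𝓝 0) := by
  set C := ‖1 + c‖ * ∑' n, ‖gaussTerm a b (1 + c) (n + 1)‖ with hC
  have h1 := (tendsto_hyp3F2_div hab).norm.mul_const C
  rw [norm_zero, zero_mul] at h1
  refine squeeze_zero_norm' ?_ h1
  filter_upwards [eventually_ge_atTop 1] with N hN
  have hN0 : (0 : ℝ) < N := by exact_mod_cast hN
  have hb := natCast_mul_norm_tsum_gaussTerm_sub_one_le a b h.re_one_add h.re_sub_sub N
  rw [add_assoc, ← (h.add_nat N).gammaRatio_eq_tsum, ← hC] at hb
  rw [norm_mul, norm_div, Complex.norm_natCast]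
  calc _ = ‖hyp3F2 a b N (a + b) (1 + N) 1‖ / N * (N * ‖gammaRatio a b (c + N) - 1‖) := by
        field_simp
    _ ≤ _ := by gcongr

theorem Admissible.tendsto_digammaBracket_sub {a b c : ℂ} (h : Admissible a b c)
    (h0 : Admissible a b 0) :
    Tendsto (fun N : ℕ => digammaBracket a b (c + N) - digammaBracket a b N) atTop (𝓝 0) := by
  have t1 := tendsto_tsum_gaussTerm_div a (1 - b) h.re_sub_right h.re_key
  have t0 := tendsto_tsum_gaussTerm_div a (1 - b) h0.re_sub_right h0.re_key
  have td := tendsto_digamma_sub_digamma h.re_sub_right h0.re_sub_right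
  have := td.sub (t1.sub t0)
  rw [sub_zero, sub_zero] at this
  refine this.congr fun N => ?_
  simp_rw [digammaBracket, keyTerm_succ]
  rw [show 1 + (c + N) - b = 1 + c - b + N by ring, show 1 + 0 - b + N = 1 + (N : ℂ) - b by ring]
  ring

theorem Admissible.tendsto_evaluationDefect_sub {a b c : ℂ} (h : Admissible a b c)
    (h0 : Admissible a b 0) (hab : ∀ m : ℕ, a + b ≠ -m) :
    Tendsto (fun N : ℕ => evaluationDefect a b (c + N) - evaluationDefect a b N)
      atTop (𝓝 0) := by
  have q1 := h.tendsto_gammaRatio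
  have q0 := h0.tendsto_gammaRatio
  have E1 := h.tendsto_hyp3F2_mul_gammaRatio_sub_one hab
  have E0 := h0.tendsto_hyp3F2_mul_gammaRatio_sub_one hab
  have hF := tendsto_hyp3F2_sub hab h.re_c
  have hB := (h.tendsto_digammaBracket_sub h0).const_mul
    (Complex.Gamma (a + b) / (Complex.Gamma a * Complex.Gamma b))
  -- With F₁, q₁ taken at c+N and F₀, q₀ at N: F₁/q₁ − F₀/q₀ = (F₁ − F₀)/q₁ + F₀(q₀ − q₁)/(q₁q₀).
  have key := ((hF.div q1 one_ne_zero).add ((E0.sub E1).div (q1.mul q0) (by simp))).sub hB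
  simp only [zero_div, sub_zero, mul_zero, add_zero] at key
  refine key.congr fun N => ?_
  have n1 := (h.add_nat N).gammaRatio_ne_zero
  have n0 := (h0.add_nat N).gammaRatio_ne_zero
  rw [zero_add] at n0
  simp only [evaluationDefect, zero_add, Pi.div_apply]
  field_simp
  ring

theorem Admissible.evaluationDefect_eq {a b c : ℂ} (h : Admissible a b c)
    (h0 : Admissible a b 0) (hab : ∀ m : ℕ, a + b ≠ -m) :
    evaluationDefect a b c = evaluationDefect a b 0 := by
  have key := eq_zero_of_tendsto_of_forall_succ_eq (fun N => ?_)
    (h.tendsto_evaluationDefect_sub h0 hab)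
  · simpa [sub_eq_zero] using key
  · have e1 := (h.add_nat N).evaluationDefect_add_one hab
    have e0 := (h0.add_nat N).evaluationDefect_add_one hab
    rw [zero_add] at e0
    push_cast
    rw [← add_assoc, e1, e0]

theorem mainTheorem4 :
    ∃ δ : ℝ, 0 < δ ∧ ∀ a b c : ℂ,
      |a.re| < δ → |b.re| < δ → |c.re| < δ →
      a ≠ 0 → b ≠ 0 → a + b ≠ 0 →
      Summable (fun n : ℕ => hyp3F2Term a b c (a + b) (1 + c) 1 n) ∧
      Summable (fun n : ℕ => keyTerm a b c (n + 1)) ∧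
      hyp3F2 a b c (a + b) (1 + c) 1 =
        gammaFactor a b c *
            (Complex.digamma (1 + c - b) - Complex.digamma a - Complex.digamma b
              - (Real.eulerMascheroniConstant : ℂ))
          - gammaFactor a b c * ∑' n : ℕ, keyTerm a b c (n + 1) := by
  -- Any δ ≤ 1/3 would do: the tightest condition is Re(1+c−a−b) > 0.
  refine ⟨1 / 10, by norm_num, fun a b c ha hb hc ha0 hb0 hab0 => ?_⟩
  obtain ⟨ha1, ha2⟩ := abs_lt.1 ha
  obtain ⟨hb1, hb2⟩ := abs_lt.1 hb
  obtain ⟨hc1, hc2⟩ := abs_lt.1 hc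
  have h : Admissible a b c := by constructor <;> simp <;> linarith
  have h0 : Admissible a b 0 := by constructor <;> simp <;> linarith
  have hab1 : |(a + b).re| < 1 := by
    rw [Complex.add_re, abs_lt]; constructor <;> linarith
  have hab : ∀ m : ℕ, a + b ≠ -m := fun m => by
    simpa using ne_intCast_of_abs_re_lt_one hab1 hab0 (-m)
  refine ⟨summable_hyp3F2Term hab h.re_c, h.summable_keyTerm, ?_⟩
  have e : evaluationDefect a b c = 0 := by
    rw [h.evaluationDefect_eq h0 hab]
    exact evaluationDefect_zero (by linarith) (by linarith) hab1 ha0 hb0 hab0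
  have hq := h.gammaRatio_ne_zero
  rw [evaluationDefect, sub_eq_zero, div_eq_iff hq] at e
  rw [e, gammaFactor_eq, digammaBracket]
  ring
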